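/- Let $A$ be a finite alphabet and $\tau\colon A\to A^+$ a substitution of constant length $p\ge 2$ (that is, $|\tau(a)|=p$ for all $a\in A$; $\tau$ is extended to words by concatenation). Assume that $\tau$ is one-to-one ($\tau(a)\neq\tau(b)$ for letters $a\neq b$) and primitive (there is $n\in\mathbb N=\{0,1,2,\dots\}$ such that $a$ appears in $\tau^n(b)$ for all $a,b\in A$). Let $X_\tau\subseteq A^{\mathbb Z}$ be the smallest subshift (closed shift-invariant set) such that every word $\tau^n(a)$, $n\in\mathbb N$, $a\in A$, is a sub-word of some point of $X_\tau$; let $T$ be the shift $(x_i)_{i\in\mathbb Z}\mapsto(x_{i+1})_{i\in\mathbb Z}$ on $X_\tau$, and let $\varrho$ be any metric on $X_\tau$ inducing its topology (as a subspace of $A^{\mathbb Z}$ with the product of discrete topologies). Assume that $X_\tau$ is infinite. Then $(X_\tau,T)$ has a Li–Yorke pair, i.e. there are $x,y\in X_\tau$ with $$\limsup_{n\to\infty}\varrho(T^nx,T^ny)>0\quad\text{and}\quad\liminf_{n\to\infty}\varrho(T^nx,T^ny)=0,$$ if and only if there exist $m\in\mathbb N$, letters $a,b\in A$ with $a\neq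 b$, and (possibly empty) words $u,u',v,v'$ such that $$\tau^m(a)=uav,\qquad \tau^m(b)=u'bv',$$ $|u|=|u'|$, $|v|=|v'|$, $v\neq v'$, and $v$ coincides with $v'$ in at least one coordinate. -/

import Mathlib

open Filter Topology

/-! ### Words and substitutions

A substitution on the alphabet `A` is a map `τ : A → List A`; words are lists of letters. -/

/-- The extension of a substitution to words by concatenation. -/
def wordMap {A : Type*} (τ : A → List A) (w : List A) : List A := w.flatMap τ

/-- The word `τ ^ n (a)`, for a letter `a`. -/
def iterWord {A : Type*} (τ : A → List A) (n : ℕ) (a : A) : List A := (wordMap τ)^[n] [a]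

/-- Every letter has an image of length `p`. -/
def IsConstantLength {A : Type*} (τ : A → List A) (p : ℕ) : Prop := ∀ a, (τ a).length = p

/-- For some `n`, every letter `a` appears in every word `τ ^ n (b)`. -/
def IsPrimitiveSubst {A : Type*} (τ : A → List A) : Prop :=
  ∃ n : ℕ, ∀ a b : A, a ∈ iterWord τ n b

/-- Two words coincide in at least one coordinate. -/
def HasCoincidence {A : Type*} (v w : List A) : Prop :=
  ∃ (i : ℕ) (c : A), v[i]? = some c ∧ w[i]? = some c

/-! ### Two-sided subshifts -/

/-- The shift map `T`. -/
def shiftMap {A : Type*} (x : ℤ → A) : ℤ → A := fun i => x (i + 1)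

/-- The word `x_i x_{i+1} … x_{i+k-1}`. -/
def window {A : Type*} (x : ℤ → A) (i : ℤ) (k : ℕ) : List A :=
  List.ofFn (fun j : Fin k => x (i + (j : ℕ)))

/-- A subshift: a closed shift-invariant set of two-sided sequences. -/
def IsSubshift {A : Type*} [TopologicalSpace A] (Y : Set (ℤ → A)) : Prop :=
  IsClosed Y ∧ shiftMap '' Y = Y

/-- The word `w` is a sub-word of some point of `Y`. -/
def Admits {A : Type*} (Y : Set (ℤ → A)) (w : List A) : Prop :=
  ∃ x ∈ Y, ∃ i : ℤ, window x i w.length = w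

/-- The subshift `X_τ`: the smallest subshift admitting all the words `τ ^ n (a)`, built as the
intersection of all subshifts that admit them (see `substShift_isLeast`). -/
def substShift {A : Type*} [TopologicalSpace A] (τ : A → List A) : Set (ℤ → A) :=
  ⋂₀ {Y | IsSubshift Y ∧ ∀ (n : ℕ) (a : A), Admits Y (iterWord τ n a)}

theorem shiftMap_mem_substShift {A : Type*} [TopologicalSpace A] (τ : A → List A) :
    Set.MapsTo shiftMap (substShift τ) (substShift τ) := by
  intro x hx Y hY
  rw [← hY.1.2]
  exact ⟨x, hx Y hY, rfl⟩

/-- The restriction of the shift map to `X_τ`. -/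
def substShiftMap {A : Type*} [TopologicalSpace A] (τ : A → List A) :
    substShift τ → substShift τ :=
  (shiftMap_mem_substShift τ).restrict

/-! ### Li–Yorke pairs -/

/-- `{x, y}` is a Li–Yorke pair of the system `(X, T)`: it is proximal but not asymptotic. -/
def IsLiYorkePair {X : Type*} [MetricSpace X] (T : X → X) (x y : X) : Prop :=
  0 < limsup (fun n : ℕ => dist (T^[n] x) (T^[n] y)) atTop ∧
    liminf (fun n : ℕ => dist (T^[n] x) (T^[n] y)) atTop = 0

/-! ### The subshift `X_τ` is well defined

For a primitive substitution of constant length at least two, the intersection `X_τ` is indeed the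
smallest subshift admitting all the words `τ ^ n (a)`, and it is the set of the sequences all of
whose sub-words are sub-words of these. -/

theorem wordMap_iter_append {A : Type*} (τ : A → List A) (n : ℕ) (u v : List A) :
    (wordMap τ)^[n] (u ++ v) = (wordMap τ)^[n] u ++ (wordMap τ)^[n] v := by
  induction n generalizing u v with
  | zero => rfl
  | succ n ih =>
    simp only [Function.iterate_succ, Function.comp]
    rw [show wordMap τ (u ++ v) = wordMap τ u ++ wordMap τ v from List.flatMap_append, ih]

theorem wordMap_iter_length {A : Type*} {τ : A → List A} {p : ℕ} (h : IsConstantLength τ p)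
    (n : ℕ) (w : List A) : ((wordMap τ)^[n] w).length = p ^ n * w.length := by
  induction n generalizing w with
  | zero => simp
  | succ n ih =>
    have h1 : (wordMap τ w).length = p * w.length := by
      induction w with
      | nil => simp [wordMap]
      | cons a w ihw =>
        have : wordMap τ (a :: w) = τ a ++ wordMap τ w := by simp [wordMap]
        rw [this, List.length_append, ihw, h a, List.length_cons]
        ring
    rw [Function.iterate_succ_apply, ih, h1, pow_succ]
    ring

theorem exists_mem_iterWord {A : Type*} {τ : A → List A} {p : ℕ} (h : IsConstantLength τ p)
    (hp : 2 ≤ p) (hprim : IsPrimitiveSubst τ) (K n : ℕ) (a : A) :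
    ∃ (N : ℕ) (b : A) (u v : List A), K ≤ u.length ∧ K ≤ v.length ∧
      iterWord τ N b = u ++ iterWord τ n a ++ v := by
  obtain ⟨M, hM⟩ := hprim
  have hlen : ((wordMap τ)^[2] [a]).length = p ^ 2 * 1 := wordMap_iter_length h 2 [a]
  obtain ⟨c0, c, c2, r, hr⟩ : ∃ c0 c c2 r, (wordMap τ)^[2] [a] = c0 :: c :: c2 :: r := by
    have h3 : 3 ≤ ((wordMap τ)^[2] [a]).length := by rw [hlen]; nlinarith
    match hw : (wordMap τ)^[2] [a], h3 with
    | c0 :: c :: c2 :: r, _ => exact ⟨c0, c, c2, r, rfl⟩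
  have hK : ∀ k : ℕ, k ≤ p ^ k := fun k => (Nat.lt_pow_self (by omega)).le
  have ha : a ∈ (wordMap τ)^[M + K] [c] := by
    rw [Function.iterate_add_apply]
    have hl : 1 ≤ ((wordMap τ)^[K] [c]).length := by
      rw [wordMap_iter_length h]
      simpa using Nat.one_le_pow _ _ (by omega)
    match hw : (wordMap τ)^[K] [c], hl with
    | d :: t, _ =>
      rw [show d :: t = [d] ++ t from rfl, wordMap_iter_append]
      exact List.mem_append_left _ (hM a d)
  obtain ⟨s, t, hst⟩ := List.append_of_mem ha
  refine ⟨n + (M + K) + 2, a, (wordMap τ)^[n + (M + K)] [c0] ++ (wordMap τ)^[n] s,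
    (wordMap τ)^[n] t ++ (wordMap τ)^[n + (M + K)] (c2 :: r), ?_, ?_, ?_⟩
  · rw [List.length_append, wordMap_iter_length h]
    have := hK (n + (M + K))
    simp only [List.length_singleton]
    omega
  · rw [List.length_append, wordMap_iter_length h (n + (M + K))]
    have := hK (n + (M + K))
    simp only [List.length_cons]
    nlinarith [Nat.zero_le (p ^ (n + (M + K)) * r.length)]
  · have h1 : iterWord τ (n + (M + K) + 2) a
        = (wordMap τ)^[n + (M + K)] ([c0] ++ [c] ++ (c2 :: r)) := by
      rw [iterWord, Function.iterate_add_apply, hr]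
      rfl
    have h2 : (wordMap τ)^[n + (M + K)] [c]
        = (wordMap τ)^[n] s ++ iterWord τ n a ++ (wordMap τ)^[n] t := by
      rw [Function.iterate_add_apply, hst, show s ++ a :: t = s ++ [a] ++ t by simp,
        wordMap_iter_append, wordMap_iter_append]
      rfl
    rw [h1, wordMap_iter_append, wordMap_iter_append, h2]
    simp only [List.append_assoc]

theorem window_length {A : Type*} (x : ℤ → A) (i : ℤ) (k : ℕ) : (window x i k).length = k := by
  simp [window]

theorem window_eq_iff {A : Type*} (x : ℤ → A) (i : ℤ) (k : ℕ) (w : List A) (hw : w.length = k) :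
    window x i k = w ↔ ∀ j : ℕ, j < k → w[j]? = some (x (i + j)) := by
  constructor
  · rintro rfl j hj
    simp [window, hj]
  · intro h
    apply List.ext_getElem?
    intro j
    by_cases hj : j < k
    · rw [h j hj]
      simp [window, hj]
    · rw [List.getElem?_eq_none (by rw [window_length]; omega),
        List.getElem?_eq_none (by omega)]

theorem isClosed_window {A : Type*} [TopologicalSpace A] [DiscreteTopology A]
    (S : Set (List A)) (i : ℤ) (k : ℕ) : IsClosed {x : ℤ → A | window x i k ∈ S} := by
  have hc : Continuous (fun (x : ℤ → A) (j : Fin k) => x (i + (j : ℕ))) := by fun_prop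
  exact (isClosed_discrete {f : Fin k → A | List.ofFn f ∈ S}).preimage hc

theorem IsSubshift.translate_mem {A : Type*} [TopologicalSpace A] {Y : Set (ℤ → A)}
    (hY : IsSubshift Y) (z : ℤ) : ∀ y ∈ Y, (fun i => y (i + z)) ∈ Y := by
  induction z using Int.induction_on with
  | zero => simp
  | succ n ih =>
    intro y hy
    have h1 : shiftMap (fun i => y (i + (n : ℤ))) ∈ Y := by
      rw [← hY.2]
      exact ⟨_, ih y hy, rfl⟩
    convert h1 using 1
    funext i
    simp only [shiftMap]
    congr 1
    ring
  | pred n ih =>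
    intro y hy
    have h1 := ih y hy
    rw [← hY.2] at h1
    obtain ⟨y', hy', he⟩ := h1
    convert hy' using 1
    funext i
    have := congrFun he (i - 1)
    simp only [shiftMap] at this
    rw [show i - 1 + 1 = i by ring] at this
    rw [this]
    congr 1
    ring

/-- The sequences all of whose sub-words are sub-words of the words `τ ^ n (a)` form the smallest
subshift admitting all these words. -/
theorem isLeast_language {A : Type*} [Finite A] [TopologicalSpace A] [DiscreteTopology A]
    {τ : A → List A} {p : ℕ} (h : IsConstantLength τ p) (hp : 2 ≤ p)
    (hprim : IsPrimitiveSubst τ) :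
    IsLeast {Y | IsSubshift Y ∧ ∀ (n : ℕ) (a : A), Admits Y (iterWord τ n a)}
      {x : ℤ → A | ∀ (i : ℤ) (k : ℕ), ∃ (n : ℕ) (a : A), window x i k <:+: iterWord τ n a} := by
  refine ⟨⟨⟨?_, ?_⟩, ?_⟩, ?_⟩
  · simp only [Set.ofPred_forall]
    exact isClosed_iInter fun i => isClosed_iInter fun k =>
      isClosed_window {w | ∃ (n : ℕ) (a : A), w <:+: iterWord τ n a} i k
  · have hw : ∀ (x : ℤ → A) (z i : ℤ) (k : ℕ),
        window (fun j => x (j + z)) i k = window x (i + z) k := by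
      intro x z i k
      simp only [window]
      congr 1
      funext j
      congr 1
      ring
    apply Set.Subset.antisymm
    · rintro _ ⟨x, hx, rfl⟩ i k
      have := hx (i + 1) k
      rwa [← hw] at this
    · intro x hx
      refine ⟨fun j => x (j + (-1)), fun i k => ?_, ?_⟩
      · rw [hw]
        exact hx _ k
      · funext j
        simp [shiftMap]
  · intro n a
    set w := iterWord τ n a with hwdef
    let C : ℕ → Set (ℤ → A) := fun K => {x | window x 0 w.length ∈ ({w} : Set (List A))} ∩
      {x | ∀ (i : ℤ) (k : ℕ), -(K : ℤ) ≤ i → i + k ≤ w.length + K →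
        window x i k ∈ {v | ∃ (n : ℕ) (a : A), v <:+: iterWord τ n a}}
    have hcl : ∀ K, IsClosed (C K) := by
      intro K
      refine (isClosed_window _ _ _).inter ?_
      simp only [Set.ofPred_forall]
      exact isClosed_iInter fun i => isClosed_iInter fun k => isClosed_iInter fun _ =>
        isClosed_iInter fun _ => isClosed_window _ i k
    have hne : ∀ K, (C K).Nonempty := by
      intro K
      obtain ⟨N, b, u, v, hu, hv, huv⟩ := exists_mem_iterWord h hp hprim K n a
      rw [← hwdef] at huv
      let z : ℤ → A := fun i => (u ++ w ++ v).getD (i + u.length).toNat a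
      have hz : ∀ (i : ℤ) (k : ℕ), -(u.length : ℤ) ≤ i → i + k ≤ w.length + v.length →
          window z i k = ((u ++ w ++ v).drop (i + u.length).toNat).take k := by
        intro i k hi hk
        rw [window_eq_iff]
        · intro j hj
          rw [List.getElem?_take_of_lt hj, List.getElem?_drop]
          have e : (i + (j : ℤ) + u.length).toNat = (i + u.length).toNat + j := by omega
          have hlt : (i + u.length).toNat + j < (u ++ w ++ v).length := by
            simp only [List.length_append]
            omega
          simp only [z, e]
          rw [List.getD_eq_getElem _ _ hlt, List.getElem?_eq_getElem hlt]
        · simp only [List.length_take, List.length_drop, List.length_append]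
          omega
      refine ⟨z, ?_, ?_⟩
      · change window z 0 w.length = w
        rw [hz _ _ (by omega) (by omega)]
        simp
      · intro i k hi hk
        refine ⟨N, b, ?_⟩
        rw [hz _ _ (by omega) (by omega), huv]
        exact (List.take_prefix _ _).isInfix.trans (List.drop_suffix _ _).isInfix
    have hmono : ∀ K, C (K + 1) ⊆ C K := by
      rintro K x ⟨h1, h2⟩
      refine ⟨h1, fun i k hi hk => h2 i k ?_ ?_⟩ <;> push_cast <;> omega
    obtain ⟨x, hx⟩ := IsCompact.nonempty_iInter_of_sequence_nonempty_isCompact_isClosed C hmono hne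
      (hcl 0).isCompact hcl
    rw [Set.mem_iInter] at hx
    refine ⟨x, fun i k => ?_, 0, (hx 0).1⟩
    exact (hx (i.natAbs + k)).2 i k (by omega) (by omega)
  · rintro Y ⟨hY, hadm⟩ x hx
    have key : ∀ K : ℕ, ∃ y ∈ Y, ∀ i : ℤ, -(K : ℤ) ≤ i → i ≤ K → y i = x i := by
      intro K
      obtain ⟨n, a, s, t, hst⟩ := hx (-(K : ℤ)) (2 * K + 1)
      obtain ⟨y, hy, i, hi⟩ := hadm n a
      refine ⟨fun j => y (j + (i + s.length + K)), hY.translate_mem _ y hy, fun j hj1 hj2 => ?_⟩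
      rw [window_eq_iff _ _ _ _ rfl] at hi
      have hlen : (iterWord τ n a).length = s.length + (2 * K + 1) + t.length := by
        rw [← hst]
        simp only [List.length_append, window_length]
      have h1 := hi (s.length + (j + K).toNat) (by omega)
      have h2 := (window_eq_iff x (-(K : ℤ)) (2 * K + 1) _ (window_length _ _ _)).1 rfl
        (j + K).toNat (by omega)
      rw [← hst, List.append_assoc, List.getElem?_append_right (by omega),
        List.getElem?_append_left (by rw [window_length]; omega), Nat.add_sub_cancel_left, h2] at h1
      have h3 := Option.some.inj h1
      rw [show -(K : ℤ) + ((j + K).toNat : ℤ) = j by omega] at h3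
      rw [h3]
      change y (j + (i + s.length + K)) = _
      congr 1
      omega
    choose y hyY hyx using key
    refine hY.1.mem_of_tendsto (f := y) (b := atTop) ?_ (Eventually.of_forall hyY)
    rw [tendsto_pi_nhds]
    intro i
    refine tendsto_const_nhds.congr' ?_
    filter_upwards [eventually_ge_atTop i.natAbs] with K hK
    exact (hyx K i (by omega) (by omega)).symm

theorem substShift_isLeast {A : Type*} [Finite A] [TopologicalSpace A] [DiscreteTopology A]
    {τ : A → List A} {p : ℕ} (h : IsConstantLength τ p) (hp : 2 ≤ p)
    (hprim : IsPrimitiveSubst τ) :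
    IsLeast {Y | IsSubshift Y ∧ ∀ (n : ℕ) (a : A), Admits Y (iterWord τ n a)}
      (substShift τ) := by
  have h1 := isLeast_language h hp hprim
  rwa [show substShift τ = _ from h1.isGLB.sInf_eq]

theorem mem_substShift_iff {A : Type*} [Finite A] [TopologicalSpace A] [DiscreteTopology A]
    {τ : A → List A} {p : ℕ} (h : IsConstantLength τ p) (hp : 2 ≤ p)
    (hprim : IsPrimitiveSubst τ) (x : ℤ → A) :
    x ∈ substShift τ ↔
      ∀ (i : ℤ) (k : ℕ), ∃ (n : ℕ) (a : A), window x i k <:+: iterWord τ n a := by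
  rw [show substShift τ = _ from (isLeast_language h hp hprim).isGLB.sInf_eq]
  rfl

/-!
In coordinates, a Li–Yorke pair of `X_τ` is a pair of sequences that differ at arbitrarily large
positions but agree on arbitrarily long windows far to the right. Such a pair `x, y` can be
desubstituted with a common offset: `x = T ^ r (τ (x'))` and `y = T ^ r (τ (y'))`. Indeed the long
windows give, by compactness, a point of `X_τ` that has both the offset of `x` and that of `y`, and
by minimality every point with the first offset then also has the second one. As `τ` is injective,
`x', y'` is a Li–Yorke pair again, so this can be iterated. There is `β ∈ {0, 1}` such that, in all
the late pairs of the resulting sequence, each bounded set of positions `≥ β` lies in the image of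
the letters at position `β` of a much later pair. Some letters `a`, `b` occur at position `β`
infinitely often, which exhibits `a` and `b` inside `τ ^ m (a)` and `τ ^ m (b)`, at the same
position and followed by both an agreement and a difference.

Conversely, if `τ ^ m (a)` and `τ ^ m (b)` have `a` and `b` at position `r`, then the map
`Φ = T ^ r ∘ τ ^ m` preserves `{x | x 0 = a}` and `{x | x 0 = b}`. By compactness there are `x` and
`y` in all the images `Φ ^ k {x | x 0 = a}` and `Φ ^ k {x | x 0 = b}` respectively. An agreement or
a difference to the right of `r` is blown up by `Φ ^ k` to blocks of length `p ^ (m * k)`, further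
and further to the right.
-/

section Words

variable {A : Type*} {τ : A → List A} {p : ℕ}

/-- The letter at position `i` of the word `τ ^ n (a)`; the value is `a` for `i` beyond the length
of this word. -/
def letterAt (τ : A → List A) (n : ℕ) (a : A) (i : ℕ) : A :=
  (iterWord τ n a).getD i a

theorem letterAt_zero (a : A) : letterAt τ 0 a 0 = a := rfl

theorem iterWord_length (h : IsConstantLength τ p) (n : ℕ) (a : A) :
    (iterWord τ n a).length = p ^ n := by
  rw [iterWord, wordMap_iter_length h, List.length_singleton, mul_one]

theorem iterWord_getElem? (h : IsConstantLength τ p) {n i : ℕ} {a : A} (hi : i < p ^ n) :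
    (iterWord τ n a)[i]? = some (letterAt τ n a i) := by
  have hl : i < (iterWord τ n a).length := by rwa [iterWord_length h]
  rw [letterAt, List.getD_eq_getElem _ _ hl, List.getElem?_eq_getElem hl]

theorem wordMap_iter_getElem? (h : IsConstantLength τ p) {n q t : ℕ} (ht : t < p ^ n)
    {w : List A} {b : A} (hb : w[q]? = some b) :
    ((wordMap τ)^[n] w)[q * p ^ n + t]? = some (letterAt τ n b t) := by
  obtain ⟨hq, rfl⟩ := List.getElem?_eq_some_iff.1 hb
  have hsplit : (wordMap τ)^[n] w = (wordMap τ)^[n] (w.take q) ++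
      (iterWord τ n w[q] ++ (wordMap τ)^[n] (w.drop (q + 1))) := by
    rw [iterWord, ← wordMap_iter_append, ← wordMap_iter_append, List.singleton_append,
      ← List.drop_eq_getElem_cons, List.take_append_drop]
  have hl : ((wordMap τ)^[n] (w.take q)).length = q * p ^ n := by
    rw [wordMap_iter_length h, List.length_take_of_le hq.le, mul_comm]
  rw [hsplit, List.getElem?_append_right (by omega), hl, Nat.add_sub_cancel_left,
    List.getElem?_append_left (by rwa [iterWord_length h]), iterWord_getElem? h ht]

theorem mul_pow_add_lt_pow_add {m n q t : ℕ} (hq : q < p ^ n) (ht : t < p ^ m) :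
    q * p ^ m + t < p ^ (m + n) :=
  calc q * p ^ m + t < (q + 1) * p ^ m := by linarith
    _ ≤ p ^ n * p ^ m := Nat.mul_le_mul_right _ hq
    _ = p ^ (m + n) := by ring

theorem letterAt_add (h : IsConstantLength τ p) {m n q t : ℕ} (a : A) (hq : q < p ^ n)
    (ht : t < p ^ m) :
    letterAt τ (m + n) a (q * p ^ m + t) = letterAt τ m (letterAt τ n a q) t := by
  rw [← Option.some_inj, ← iterWord_getElem? h (mul_pow_add_lt_pow_add hq ht),
    ← wordMap_iter_getElem? h ht (iterWord_getElem? h hq), iterWord, Function.iterate_add_apply]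
  rfl

theorem eq_of_forall_letterAt_eq (h : IsConstantLength τ p) (hinj : Function.Injective τ) {n : ℕ}
    {a b : A} (hab : ∀ t < p ^ n, letterAt τ n a t = letterAt τ n b t) : a = b := by
  induction n with
  | zero => exact hab 0 (by simp)
  | succ n ih =>
    refine ih fun q hq => hinj ?_
    have hτ (c : A) : τ c = iterWord τ 1 c := by simp [iterWord, wordMap]
    rw [hτ, hτ]
    refine List.ext_getElem? fun t => ?_
    by_cases ht : t < p ^ 1
    · rw [iterWord_getElem? h ht, iterWord_getElem? h ht, ← letterAt_add h a hq ht,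
        ← letterAt_add h b hq ht, add_comm 1 n, hab]
      exact add_comm 1 n ▸ mul_pow_add_lt_pow_add hq ht
    · rw [List.getElem?_eq_none (by rw [iterWord_length h]; omega),
        List.getElem?_eq_none (by rw [iterWord_length h]; omega)]

end Words

section Inflate

variable {A : Type*} {τ : A → List A} {p : ℕ}

/-- The sequence `T ^ z (τ ^ n (x))`, for `τ` of constant length `p`. For `n = 0` this is the
translate `T ^ z (x)`. -/
def inflate (τ : A → List A) (p n : ℕ) (z : ℤ) (x : ℤ → A) : ℤ → A :=
  fun i => letterAt τ n (x ((i + z) / (p : ℤ) ^ n)) ((i + z) % (p : ℤ) ^ n).toNat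

theorem inflate_apply (x : ℤ → A) {n t : ℕ} {i z q : ℤ}
    (ht : t < p ^ n) (hi : i + z = q * (p : ℤ) ^ n + t) :
    inflate τ p n z x i = letterAt τ n (x q) t := by
  have ht' : (t : ℤ) < (p : ℤ) ^ n := by exact_mod_cast ht
  have hq : (i + z) / (p : ℤ) ^ n = q := by
    rw [hi, add_comm, Int.add_mul_ediv_right _ _ (by omega),
      Int.ediv_eq_zero_of_lt (by omega) ht', zero_add]
  have ht : (i + z) % (p : ℤ) ^ n = t := by
    rw [hi, add_comm, Int.add_mul_emod_self_right, Int.emod_eq_of_lt (by omega) ht']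
  rw [inflate, hq, ht, Int.toNat_natCast]

theorem inflate_zero (z : ℤ) (x : ℤ → A) : inflate τ p 0 z x = fun i => x (i + z) := by
  funext i
  rw [inflate_apply x (t := 0) (by simp) (by simp; rfl), letterAt_zero]

theorem exists_eq_mul_pow_add (hp : 0 < p) (n : ℕ) (i : ℤ) :
    ∃ (q : ℤ) (t : ℕ), t < p ^ n ∧ i = q * (p : ℤ) ^ n + t := by
  have hP : (0 : ℤ) < (p : ℤ) ^ n := by positivity
  lift i % (p : ℤ) ^ n to ℕ using Int.emod_nonneg i hP.ne' with t ht
  refine ⟨i / (p : ℤ) ^ n, t, ?_, ?_⟩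
  · exact_mod_cast ht ▸ Int.emod_lt_of_pos i hP
  · rw [ht, Int.ediv_mul_add_emod]

theorem inflate_inflate (h : IsConstantLength τ p) (hp : 0 < p) (m n : ℕ) (z w : ℤ) (x : ℤ → A) :
    inflate τ p m z (inflate τ p n w x) = inflate τ p (m + n) (z + w * (p : ℤ) ^ m) x := by
  funext i
  obtain ⟨q, t, ht, hi⟩ := exists_eq_mul_pow_add hp m (i + z)
  obtain ⟨q', t', ht', hq⟩ := exists_eq_mul_pow_add hp n (q + w)
  rw [inflate_apply _ ht hi, inflate_apply _ ht' hq, ← letterAt_add h _ ht' ht,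
    inflate_apply _ (mul_pow_add_lt_pow_add ht' ht)]
  push_cast
  linear_combination hi + (p : ℤ) ^ m * hq

theorem translate_inflate (n : ℕ) (z w : ℤ) (x : ℤ → A) :
    (fun i => inflate τ p n z x (i + w)) = inflate τ p n (z + w) x := by
  funext i
  simp only [inflate, add_assoc, add_comm w]

theorem inflate_translate (h : IsConstantLength τ p) (hp : 0 < p) (n : ℕ) (z w : ℤ) (x : ℤ → A) :
    inflate τ p n z (fun i => x (i + w)) = inflate τ p n (z + w * (p : ℤ) ^ n) x := by
  rw [← inflate_zero (τ := τ) (p := p), inflate_inflate h hp, add_zero]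

theorem continuous_inflate [TopologicalSpace A] [DiscreteTopology A] (τ : A → List A) (p n : ℕ)
    (z : ℤ) :
    Continuous (inflate τ p n z) :=
  continuous_pi fun i => (continuous_of_discreteTopology
    (f := fun a => letterAt τ n a ((i + z) % (p : ℤ) ^ n).toNat)).comp (continuous_apply _)

theorem inflate_eqOn_Ico_iff (h : IsConstantLength τ p) (hinj : Function.Injective τ) (n : ℕ)
    (z q : ℤ) (x y : ℤ → A) :
    Set.EqOn (inflate τ p n z x) (inflate τ p n z y)
      (Set.Ico (q * (p : ℤ) ^ n - z) ((q + 1) * (p : ℤ) ^ n - z)) ↔ x q = y q := by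
  constructor
  · refine fun hxy => eq_of_forall_letterAt_eq (n := n) h hinj fun t ht => ?_
    have ht' : (t : ℤ) < (p : ℤ) ^ n := by exact_mod_cast ht
    have hi : q * (p : ℤ) ^ n + t - z + z = q * (p : ℤ) ^ n + t := by ring
    rw [← inflate_apply x ht hi, ← inflate_apply y ht hi]
    exact hxy ⟨by linarith, by linarith⟩
  · rintro hxy i ⟨hi₁, hi₂⟩
    obtain ⟨t, ht⟩ := Int.eq_ofNat_of_zero_le (sub_nonneg.2 (sub_le_iff_le_add.1 hi₁))
    have hi : i + z = q * (p : ℤ) ^ n + t := by linarith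
    have ht' : t < p ^ n := by zify; linarith
    rw [inflate_apply x ht' hi, inflate_apply y ht' hi, hxy]

end Inflate

section SubstShift

variable {A : Type*} {τ : A → List A} {p : ℕ}

theorem admits_iterWord_iff (h : IsConstantLength τ p) {Y : Set (ℤ → A)} {n : ℕ} {a : A} :
    Admits Y (iterWord τ n a) ↔ ∃ x ∈ Y, ∃ i : ℤ, ∀ t < p ^ n, x (i + t) = letterAt τ n a t := by
  refine exists_congr fun x => and_congr_right fun _ => exists_congr fun i => ?_
  rw [window_eq_iff _ _ _ _ rfl, iterWord_length h]
  refine forall₂_congr fun t ht => ?_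
  rw [iterWord_getElem? h ht, Option.some_inj, eq_comm]

theorem Admits.iterWord_letterAt (h : IsConstantLength τ p) {Y : Set (ℤ → A)} {m n q : ℕ} {a : A}
    (hY : Admits Y (iterWord τ (m + n) a)) (hq : q < p ^ n) :
    Admits Y (iterWord τ m (letterAt τ n a q)) := by
  rw [admits_iterWord_iff h] at hY ⊢
  obtain ⟨x, hx, i, hi⟩ := hY
  refine ⟨x, hx, i + q * (p : ℤ) ^ m, fun t ht => ?_⟩
  rw [← letterAt_add h a hq ht, ← hi _ (mul_pow_add_lt_pow_add hq ht)]
  push_cast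
  rw [add_assoc]

theorem inflate_eq_letterAt_add (h : IsConstantLength τ p) {m : ℕ} {x : ℤ → A} {i : ℤ} {a : A}
    (hx : ∀ q < p ^ m, x (i + q) = letterAt τ m a q) (n : ℕ) :
    ∀ t < p ^ (n + m), inflate τ p n (i * (p : ℤ) ^ n) x (0 + t) = letterAt τ (n + m) a t := by
  intro t ht
  have hP : 0 < p ^ n := Nat.pos_of_ne_zero fun h0 => by simp [pow_add, h0] at ht
  have hq : t / p ^ n < p ^ m := Nat.div_lt_of_lt_mul (pow_add p n m ▸ ht)
  have hdiv : t / p ^ n * p ^ n + t % p ^ n = t := Nat.div_add_mod' t (p ^ n)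
  conv_rhs => rw [← hdiv]
  rw [letterAt_add h a hq (Nat.mod_lt t hP), ← hx _ hq, inflate_apply x (Nat.mod_lt t hP)]
  conv_lhs => rw [← hdiv]
  push_cast
  ring

theorem IsPrimitiveSubst.exists_letterAt_eq (hprim : IsPrimitiveSubst τ)
    (h : IsConstantLength τ p) : ∃ M : ℕ, ∀ a b : A, ∃ q < p ^ M, letterAt τ M b q = a := by
  obtain ⟨M, hM⟩ := hprim
  refine ⟨M, fun a b => ?_⟩
  obtain ⟨q, hq, hqa⟩ := List.getElem_of_mem (hM a b)
  refine ⟨q, iterWord_length h M b ▸ hq, ?_⟩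
  rw [letterAt, List.getD_eq_getElem _ _ hq, hqa]

theorem admits_iterWord_of_forall_exists (h : IsConstantLength τ p) (hprim : IsPrimitiveSubst τ)
    {Y : Set (ℤ → A)} (hY : ∀ N, ∃ b, Admits Y (iterWord τ N b)) (n : ℕ) (a : A) :
    Admits Y (iterWord τ n a) := by
  obtain ⟨M, hM⟩ := hprim.exists_letterAt_eq h
  obtain ⟨b, hb⟩ := hY (n + M)
  obtain ⟨q, hq, rfl⟩ := hM a b
  exact hb.iterWord_letterAt h hq

theorem isSubshift_of_forall_translate_mem [TopologicalSpace A] {Y : Set (ℤ → A)}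
    (hcl : IsClosed Y) (hY : ∀ y ∈ Y, ∀ z : ℤ, (fun i => y (i + z)) ∈ Y) : IsSubshift Y := by
  refine ⟨hcl, Set.Subset.antisymm (Set.image_subset_iff.2 fun y hy => hY y hy 1) fun y hy =>
    ⟨_, hY y hy (-1), ?_⟩⟩
  funext i
  simp only [shiftMap, add_neg_cancel_right]

variable [Finite A] [TopologicalSpace A] [DiscreteTopology A]

theorem isCompact_substShift (h : IsConstantLength τ p) (hp : 2 ≤ p) (hprim : IsPrimitiveSubst τ) :
    IsCompact (substShift τ) :=
  (substShift_isLeast h hp hprim).1.1.1.isCompact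

theorem translate_mem_substShift (h : IsConstantLength τ p) (hp : 2 ≤ p)
    (hprim : IsPrimitiveSubst τ) {x : ℤ → A} (hx : x ∈ substShift τ) (z : ℤ) :
    (fun i => x (i + z)) ∈ substShift τ :=
  (substShift_isLeast h hp hprim).1.1.translate_mem z x hx

theorem exists_mem_substShift_apply_zero_eq (h : IsConstantLength τ p) (hp : 2 ≤ p)
    (hprim : IsPrimitiveSubst τ) (a : A) : ∃ x ∈ substShift τ, x 0 = a := by
  obtain ⟨x, hx, i, hi⟩ :=
    (admits_iterWord_iff h).1 ((substShift_isLeast h hp hprim).1.2 0 a)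
  refine ⟨_, translate_mem_substShift h hp hprim hx i, ?_⟩
  simpa only [zero_add, Nat.cast_zero, add_zero, letterAt_zero] using hi 0 (by simp)

theorem exists_inflate_eq_of_mem_substShift (h : IsConstantLength τ p) (hp : 2 ≤ p)
    (hprim : IsPrimitiveSubst τ) (n : ℕ) {x : ℤ → A} (hx : x ∈ substShift τ) :
    ∃ y ∈ substShift τ, ∃ r < p ^ n, inflate τ p n (r : ℕ) y = x := by
  have hp0 : 0 < p := by omega
  have hX := substShift_isLeast h hp hprim
  let Y : Set (ℤ → A) := ⋃ r ∈ Set.Iio (p ^ n), inflate τ p n (r : ℕ) '' substShift τ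
  have mem_Y {z : ℤ → A} : z ∈ Y ↔
      ∃ y ∈ substShift τ, ∃ r < p ^ n, inflate τ p n (r : ℕ) y = z := by
    simp only [Y, Set.mem_iUnion₂, Set.mem_image, Set.mem_Iio]
    exact ⟨fun ⟨r, hr, y, hy, e⟩ => ⟨y, hy, r, hr, e⟩, fun ⟨y, hy, r, hr, e⟩ => ⟨r, hr, y, hy, e⟩⟩
  have inflate_mem_Y {y : ℤ → A} (hy : y ∈ substShift τ) (z : ℤ) : inflate τ p n z y ∈ Y := by
    obtain ⟨q, t, ht, rfl⟩ := exists_eq_mul_pow_add hp0 n z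
    refine mem_Y.2 ⟨_, translate_mem_substShift h hp hprim hy q, t, ht, ?_⟩
    rw [inflate_translate h hp0, add_comm]
  have hYsub : IsSubshift Y := by
    refine isSubshift_of_forall_translate_mem ?_ fun z hz w => ?_
    · exact ((Set.finite_Iio (p ^ n)).isCompact_biUnion fun r _ =>
        (isCompact_substShift h hp hprim).image (continuous_inflate τ p n r)).isClosed
    · obtain ⟨y, hy, r, -, rfl⟩ := mem_Y.1 hz
      exact translate_inflate (τ := τ) n r w y ▸ inflate_mem_Y hy _
  refine mem_Y.1 (Set.mem_sInter.1 hx Y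
    ⟨hYsub, admits_iterWord_of_forall_exists h hprim fun N => ?_⟩)
  obtain ⟨y, hy, i, hi⟩ := (admits_iterWord_iff h).1 (hX.1.2 N (x 0))
  refine ⟨letterAt τ n (x 0) 0, Admits.iterWord_letterAt h ?_ (by positivity)⟩
  rw [add_comm N n]
  exact (admits_iterWord_iff h).2 ⟨_, inflate_mem_Y hy _, 0, inflate_eq_letterAt_add h hi n⟩

theorem substShift_subset_of_isClosed (h : IsConstantLength τ p) (hp : 2 ≤ p)
    (hprim : IsPrimitiveSubst τ) {Y : Set (ℤ → A)} (hcl : IsClosed Y)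
    (hY : ∀ y ∈ Y, ∀ z : ℤ, (fun i => y (i + z)) ∈ Y) (hne : (substShift τ ∩ Y).Nonempty) :
    substShift τ ⊆ Y := by
  obtain ⟨x, hx, hxY⟩ := hne
  refine Set.sInter_subset_of_mem ⟨isSubshift_of_forall_translate_mem hcl hY,
    admits_iterWord_of_forall_exists h hprim fun N => ?_⟩
  obtain ⟨y, -, r, -, rfl⟩ := exists_inflate_eq_of_mem_substShift h hp hprim N hx
  refine ⟨y 0, (admits_iterWord_iff h).2 ⟨_, hxY, -r, fun t ht => inflate_apply y ht ?_⟩⟩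
  ring

theorem inflate_mem_substShift (h : IsConstantLength τ p) (hp : 2 ≤ p) (hprim : IsPrimitiveSubst τ)
    {x : ℤ → A} (hx : x ∈ substShift τ) (n : ℕ) (z : ℤ) : inflate τ p n z x ∈ substShift τ := by
  have hcl := (isCompact_substShift h hp hprim).isClosed.preimage (continuous_inflate τ p n z)
  refine substShift_subset_of_isClosed h hp hprim hcl (fun y hy w => ?_) ?_ hx
  · rw [Set.mem_preimage, inflate_translate h (by omega), ← translate_inflate]
    exact translate_mem_substShift h hp hprim hy _
  · obtain ⟨y, hy, r, -, rfl⟩ := exists_inflate_eq_of_mem_substShift h hp hprim n hx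
    refine ⟨y, hy, ?_⟩
    have := translate_mem_substShift h hp hprim hx (z - r)
    rwa [translate_inflate, add_sub_cancel] at this

theorem exists_inflate_eq_inflate (h : IsConstantLength τ p) (hp : 2 ≤ p)
    (hprim : IsPrimitiveSubst τ) {n : ℕ} {z w : ℤ} {u v x : ℤ → A} (hu : u ∈ substShift τ)
    (hv : v ∈ substShift τ) (huv : inflate τ p n z u = inflate τ p n w v)
    (hx : x ∈ substShift τ) : ∃ y ∈ substShift τ, inflate τ p n w y = inflate τ p n z x := by
  have hcl := ((isCompact_substShift h hp hprim).image
    (continuous_inflate τ p n w)).isClosed.preimage (continuous_inflate τ p n z)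
  refine substShift_subset_of_isClosed h hp hprim hcl ?_ ⟨u, hu, v, hv, huv.symm⟩ hx
  rintro y ⟨y', hy', hyy'⟩ k
  refine ⟨_, translate_mem_substShift h hp hprim hy' k, ?_⟩
  rw [inflate_translate h (by omega), inflate_translate h (by omega), ← translate_inflate,
    ← translate_inflate, hyy']

end SubstShift
section Proximality

theorem exists_eq_of_forall_exists_eqOn_Icc {A X : Type*} [TopologicalSpace A] [T2Space A]
    [TopologicalSpace X] {K : Set X} (hK : IsCompact K) {f g : X → ℤ → A} (hf : Continuous f)
    (hg : Continuous g) (h : ∀ L : ℕ, ∃ x ∈ K, Set.EqOn (f x) (g x) (Set.Icc (-L : ℤ) L)) :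
    ∃ x ∈ K, f x = g x := by
  let C (L : ℕ) : Set X := {x | Set.EqOn (f x) (g x) (Set.Icc (-L : ℤ) L)}
  have hcl (L : ℕ) : IsClosed (C L) := by
    simp only [C, Set.EqOn, Set.ofPred_forall]
    exact isClosed_biInter fun i _ => isClosed_eq (by fun_prop) (by fun_prop)
  have hanti : Antitone C := fun L L' hL x hx =>
    Set.EqOn.mono (Set.Icc_subset_Icc (by simpa using hL) (by simpa using hL)) hx
  obtain ⟨x, hx, hxC⟩ := hK.inter_iInter_nonempty C hcl fun u => by
    obtain ⟨L, hL⟩ := u.exists_le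
    obtain ⟨x, hx, hxL⟩ := h L
    exact ⟨x, hx, Set.mem_iInter₂.2 fun i hi => hanti (hL i hi) hxL⟩
  refine ⟨x, hx, funext fun i => Set.mem_iInter.1 hxC i.natAbs ⟨by omega, by omega⟩⟩

/-- Being a Li–Yorke pair of the shift, in terms of coordinates: the sequences differ at arbitrarily
large positions, but agree on arbitrarily long windows arbitrarily far to the right. -/
structure IsSymbolicLiYorkePair {A : Type*} (x y : ℤ → A) : Prop where
  frequently_ne : ∃ᶠ i : ℕ in atTop, x i ≠ y i
  frequently_eqOn : ∀ L : ℕ, ∃ᶠ n : ℕ in atTop, Set.EqOn x y (Set.Icc (n - L : ℤ) (n + L))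

end Proximality

section Desubstitution

variable {A : Type*} {τ : A → List A} {p : ℕ}

theorem IsSymbolicLiYorkePair.of_inflate (h : IsConstantLength τ p) (hp : 0 < p)
    (hinj : Function.Injective τ) {s : ℕ} {x y : ℤ → A}
    (hxy : IsSymbolicLiYorkePair (inflate τ p 1 s x) (inflate τ p 1 s y)) :
    IsSymbolicLiYorkePair x y := by
  have hparent : Tendsto (fun i => (i + s) / p) atTop atTop :=
    (Nat.tendsto_div_const_atTop hp.ne').comp (tendsto_add_atTop_nat s)
  refine ⟨hparent.frequently (hxy.frequently_ne.mono fun i => mt fun hi => ?_),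
    fun L => hparent.frequently ((hxy.frequently_eqOn ((L + 1) * p)).mono fun n hn j hj => ?_)⟩
  · simp only [inflate, pow_one]
    push_cast at hi
    rw [hi]
  · rw [← inflate_eqOn_Ico_iff h hinj 1 s]
    refine hn.mono fun i ⟨hi₁, hi₂⟩ => ?_
    have hlt : (n + s) % p < p := Nat.mod_lt _ hp
    have hdiv : (n + s) / p * p + (n + s) % p = n + s := Nat.div_add_mod' _ _
    zify at hlt hdiv
    have hmod := Int.emod_nonneg ((n : ℤ) + s) (by omega : (p : ℤ) ≠ 0)
    push_cast at hj
    have hj₁ := mul_le_mul_of_nonneg_right hj.1 (Int.natCast_nonneg p)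
    have hj₂ := mul_le_mul_of_nonneg_right hj.2 (Int.natCast_nonneg p)
    rw [pow_one] at hi₁ hi₂
    rw [Set.mem_Icc]
    push_cast
    constructor <;> linarith

variable [Finite A] [TopologicalSpace A] [DiscreteTopology A]

theorem IsSymbolicLiYorkePair.exists_common_inflate (h : IsConstantLength τ p) (hp : 2 ≤ p)
    (hprim : IsPrimitiveSubst τ) {r s : ℕ} {u v : ℤ → A} (hu : u ∈ substShift τ)
    (hv : v ∈ substShift τ)
    (huv : IsSymbolicLiYorkePair (inflate τ p 1 r u) (inflate τ p 1 s v)) :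
    ∃ u' ∈ substShift τ, ∃ v' ∈ substShift τ, inflate τ p 1 r u' = inflate τ p 1 s v' := by
  have hX := isCompact_substShift h hp hprim
  have hagree (L : ℕ) : ∃ P ∈ substShift τ ×ˢ substShift τ,
      Set.EqOn (inflate τ p 1 r P.1) (inflate τ p 1 s P.2) (Set.Icc (-L : ℤ) L) := by
    obtain ⟨n, hn⟩ := (huv.frequently_eqOn (L + p)).exists
    refine ⟨(fun i => u (i + (n / p : ℕ)), fun i => v (i + (n / p : ℕ))),
      ⟨translate_mem_substShift h hp hprim hu _, translate_mem_substShift h hp hprim hv _⟩,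
      fun i hi => ?_⟩
    simp only [inflate_translate h (by omega : 0 < p), ← translate_inflate, pow_one]
    refine hn ?_
    have hlt : n % p < p := Nat.mod_lt n (by omega)
    have hdiv : n / p * p + n % p = n := Nat.div_add_mod' n p
    rw [Set.mem_Icc] at hi ⊢
    zify at hlt hdiv
    push_cast
    have hmod := Int.emod_nonneg (n : ℤ) (by omega : (p : ℤ) ≠ 0)
    constructor <;> linarith
  obtain ⟨⟨u', v'⟩, ⟨hu', hv'⟩, he⟩ := exists_eq_of_forall_exists_eqOn_Icc (hX.prod hX)
    ((continuous_inflate τ p 1 r).comp continuous_fst)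
    ((continuous_inflate τ p 1 s).comp continuous_snd) hagree
  exact ⟨u', hu', v', hv', he⟩

theorem IsSymbolicLiYorkePair.exists_inflate (h : IsConstantLength τ p) (hp : 2 ≤ p)
    (hprim : IsPrimitiveSubst τ) (hinj : Function.Injective τ) {x y : ℤ → A}
    (hx : x ∈ substShift τ) (hy : y ∈ substShift τ) (hxy : IsSymbolicLiYorkePair x y) :
    ∃ x' ∈ substShift τ, ∃ y' ∈ substShift τ, ∃ r < p, IsSymbolicLiYorkePair x' y' ∧
      x = inflate τ p 1 (r : ℕ) x' ∧ y = inflate τ p 1 (r : ℕ) y' := by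
  obtain ⟨u, hu, r, -, rfl⟩ := exists_inflate_eq_of_mem_substShift h hp hprim 1 hx
  obtain ⟨y', hy', s, hs, rfl⟩ := exists_inflate_eq_of_mem_substShift h hp hprim 1 hy
  obtain ⟨u', hu', v', hv', huv'⟩ := hxy.exists_common_inflate h hp hprim hu hy'
  obtain ⟨x', hx', he⟩ := exists_inflate_eq_inflate h hp hprim hu' hv' huv' hu
  rw [← he] at hxy ⊢
  exact ⟨x', hx', y', hy', s, by simpa using hs, hxy.of_inflate h (by omega) hinj, rfl, rfl⟩

theorem IsSymbolicLiYorkePair.exists_inflate_seq (h : IsConstantLength τ p) (hp : 2 ≤ p)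
    (hprim : IsPrimitiveSubst τ) (hinj : Function.Injective τ) {x y : ℤ → A}
    (hx : x ∈ substShift τ) (hy : y ∈ substShift τ) (hxy : IsSymbolicLiYorkePair x y) :
    ∃ (Z W : ℕ → ℤ → A) (r : ℕ → ℕ), ∀ k, IsSymbolicLiYorkePair (Z k) (W k) ∧ r k < p ∧
      Z k = inflate τ p 1 (r k) (Z (k + 1)) ∧ W k = inflate τ p 1 (r k) (W (k + 1)) := by
  let S := {P : (ℤ → A) × (ℤ → A) //
    P.1 ∈ substShift τ ∧ P.2 ∈ substShift τ ∧ IsSymbolicLiYorkePair P.1 P.2}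
  have hstep (P : S) : ∃ (Q : S) (r : ℕ), r < p ∧
      P.1.1 = inflate τ p 1 r Q.1.1 ∧ P.1.2 = inflate τ p 1 r Q.1.2 := by
    obtain ⟨x', hx', y', hy', r, hr, hxy', he⟩ :=
      P.2.2.2.exists_inflate h hp hprim hinj P.2.1 P.2.2.1
    exact ⟨⟨(x', y'), hx', hy', hxy'⟩, r, hr, he⟩
  choose next r hr using hstep
  let P (k : ℕ) : S := next^[k] ⟨(x, y), hx, hy, hxy⟩
  have hP (k : ℕ) : P (k + 1) = next (P k) := Function.iterate_succ_apply' ..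
  refine ⟨fun k => (P k).1.1, fun k => (P k).1.2, fun k => r (P k), fun k => ⟨(P k).2.2.2, ?_⟩⟩
  simpa only [hP] using hr (P k)

end Desubstitution

section Digits

/-- The integer with base-`p` digits `r k, r (k + 1), …, r (k + m - 1)`, from the least to the most
significant one: the offset accumulated over `m` successive desubstitutions with offsets `r`. -/
def digitSum (p : ℕ) (r : ℕ → ℕ) (k m : ℕ) : ℕ :=
  ∑ l ∈ Finset.range m, p ^ l * r (k + l)

variable {p : ℕ} {r : ℕ → ℕ}

theorem digitSum_succ (p : ℕ) (r : ℕ → ℕ) (k m : ℕ) :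
    digitSum p r k (m + 1) = digitSum p r k m + p ^ m * r (k + m) :=
  Finset.sum_range_succ _ _

theorem digitSum_lt (hr : ∀ k, r k < p) (k m : ℕ) : digitSum p r k m < p ^ m := by
  induction m with
  | zero => simp [digitSum]
  | succ m ih =>
    calc digitSum p r k (m + 1) = digitSum p r k m + p ^ m * r (k + m) := digitSum_succ ..
      _ < p ^ m * (r (k + m) + 1) := by linarith
      _ ≤ p ^ m * p := Nat.mul_le_mul_left _ (hr (k + m))
      _ = p ^ (m + 1) := (pow_succ p m).symm

theorem digitSum_add_one_of_forall {k : ℕ} (hr : ∀ j ≥ k, r j + 1 = p) (m : ℕ) :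
    digitSum p r k m + 1 = p ^ m := by
  induction m with
  | zero => simp [digitSum]
  | succ m ih =>
    rw [digitSum_succ, pow_succ]
    linear_combination ih + p ^ m * hr (k + m) (by omega)

theorem eventually_add_digitSum_lt (hp : 2 ≤ p) (hr : ∀ k, r k < p)
    (hfreq : ∃ᶠ j in atTop, r j + 1 < p) (k i : ℕ) :
    ∀ᶠ m in atTop, i + digitSum p r k m < p ^ m := by
  obtain ⟨j, hj, hrj⟩ := frequently_atTop.1 hfreq (k + i)
  obtain ⟨m, rfl⟩ := Nat.exists_eq_add_of_le (show k ≤ j by omega)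
  refine eventually_atTop.2 ⟨m + 1, fun m' hm' => ?_⟩
  induction m', hm' using Nat.le_induction with
  | base =>
    have hi : i < p ^ m := (by omega : i ≤ m).trans_lt (Nat.lt_pow_self (by omega))
    calc i + digitSum p r k (m + 1) = i + digitSum p r k m + p ^ m * r (k + m) := by
          rw [digitSum_succ, add_assoc]
      _ < p ^ m * (r (k + m) + 2) := by linarith [digitSum_lt hr k m]
      _ ≤ p ^ m * p := Nat.mul_le_mul_left _ hrj
      _ = p ^ (m + 1) := (pow_succ p m).symm
  | succ m' _ ih =>
    calc i + digitSum p r k (m' + 1) = i + digitSum p r k m' + p ^ m' * r (k + m') := by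
          rw [digitSum_succ, add_assoc]
      _ < p ^ m' * (r (k + m') + 1) := by linarith
      _ ≤ p ^ m' * p := Nat.mul_le_mul_left _ (hr _)
      _ = p ^ (m' + 1) := (pow_succ p m').symm

-- `β` is `1` if the digits are eventually all equal to `p - 1`, and `0` otherwise.
theorem exists_eventually_add_digitSum_div_eq (hp : 2 ≤ p) (hr : ∀ k, r k < p) :
    ∃ β : ℕ, ∀ᶠ k in atTop, ∀ i ≥ β, ∀ᶠ m in atTop, (i + digitSum p r k m) / p ^ m = β := by
  by_cases hfreq : ∃ᶠ j in atTop, r j + 1 < p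
  · exact ⟨0, .of_forall fun k i _ => (eventually_add_digitSum_lt hp hr hfreq k i).mono fun m hm =>
      Nat.div_eq_of_lt hm⟩
  · obtain ⟨K, hK⟩ := eventually_atTop.1 (not_frequently.1 hfreq)
    refine ⟨1, eventually_atTop.2 ⟨K, fun k hk i hi => eventually_atTop.2 ⟨i, fun m hm => ?_⟩⟩⟩
    have hD := digitSum_add_one_of_forall (p := p) (r := r) (k := k)
      (fun j hj => by have := hK j (by omega); have := hr j; omega) m
    have him : m < p ^ m := Nat.lt_pow_self (by omega)
    exact Nat.div_eq_of_lt_le (by omega) (by omega)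

end Digits

section Forward

variable {A : Type*} {τ : A → List A} {p : ℕ}

theorem eq_inflate_digitSum (h : IsConstantLength τ p) (hp : 0 < p) {Z : ℕ → ℤ → A} {r : ℕ → ℕ}
    (hZ : ∀ k, Z k = inflate τ p 1 (r k) (Z (k + 1))) (k m : ℕ) :
    Z k = inflate τ p m (digitSum p r k m) (Z (k + m)) := by
  induction m with
  | zero => simp [digitSum, inflate_zero]
  | succ m ih =>
    conv_lhs => rw [ih, hZ (k + m), inflate_inflate h hp]
    rw [digitSum_succ, add_assoc k m 1]
    push_cast
    rw [mul_comm ((p : ℤ) ^ m)]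

theorem apply_eq_letterAt_of_div_eq (h : IsConstantLength τ p) (hp : 0 < p) {Z : ℕ → ℤ → A}
    {r : ℕ → ℕ} (hZ : ∀ k, Z k = inflate τ p 1 (r k) (Z (k + 1))) {k m i β : ℕ}
    (hi : (i + digitSum p r k m) / p ^ m = β) :
    Z k i = letterAt τ m (Z (k + m) β) ((i + digitSum p r k m) % p ^ m) := by
  rw [eq_inflate_digitSum h hp hZ k m]
  refine inflate_apply _ (Nat.mod_lt _ (by positivity)) ?_
  rw [← hi]
  exact_mod_cast (Nat.div_add_mod' _ _).symm

/-- The words `τ ^ m (a)` and `τ ^ m (b)` have at position `r` the letters `a` and `b`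
respectively, and further to the right they agree at position `q` and differ at position `q'`. -/
structure IsBranching (τ : A → List A) (p m : ℕ) (a b : A) (r q q' : ℕ) : Prop where
  letterAt_left : letterAt τ m a r = a
  letterAt_right : letterAt τ m b r = b
  lt_eq : r < q
  lt_ne : r < q'
  eq_lt : q < p ^ m
  ne_lt : q' < p ^ m
  letterAt_eq : letterAt τ m a q = letterAt τ m b q
  letterAt_ne : letterAt τ m a q' ≠ letterAt τ m b q'

theorem mod_lt_mod_of_div_eq {P i j : ℕ} (hij : i < j) (hdiv : i / P = j / P) : i % P < j % P := by
  have hi := Nat.div_add_mod i P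
  have hj := Nat.div_add_mod j P
  rw [hdiv] at hi
  omega

theorem exists_isBranching_of_seq [Finite A] (h : IsConstantLength τ p) (hp : 2 ≤ p)
    {Z W : ℕ → ℤ → A} {r : ℕ → ℕ} (hr : ∀ k, r k < p)
    (hLY : ∀ k, IsSymbolicLiYorkePair (Z k) (W k))
    (hZ : ∀ k, Z k = inflate τ p 1 (r k) (Z (k + 1)))
    (hW : ∀ k, W k = inflate τ p 1 (r k) (W (k + 1))) :
    ∃ (m : ℕ) (a b : A) (s q q' : ℕ), IsBranching τ p m a b s q q' := by
  have hp0 : 0 < p := by omega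
  obtain ⟨β, hβ⟩ := exists_eventually_add_digitSum_div_eq hp hr
  obtain ⟨⟨a, b⟩, hab⟩ : ∃ P : A × A, ∃ᶠ k in atTop, Z k β = P.1 ∧ W k β = P.2 :=
    frequently_exists.1 (Frequently.of_forall fun k => ⟨(Z k β, W k β), rfl, rfl⟩)
  obtain ⟨k, ⟨rfl, rfl⟩, hk⟩ := (hab.and_eventually hβ).exists
  obtain ⟨q', hne, hq'⟩ := ((hLY k).frequently_ne.and_eventually (eventually_gt_atTop β)).exists
  obtain ⟨q, heq, hq⟩ :=
    (((hLY k).frequently_eqOn 0).and_eventually (eventually_gt_atTop β)).exists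
  have hqq : Z k q = W k q := heq (by simp)
  have hfreq : ∃ᶠ m in atTop, Z (k + m) β = Z k β ∧ W (k + m) β = W k β := by
    refine frequently_atTop.2 fun m₀ => ?_
    obtain ⟨k', hk', hab'⟩ := frequently_atTop.1 hab (k + m₀)
    exact ⟨k' - k, by omega, by rwa [Nat.add_sub_cancel' (by omega)]⟩
  obtain ⟨m, ⟨hZm, hWm⟩, ⟨hm, hmq⟩, hmq'⟩ :=
    (hfreq.and_eventually (((hk β le_rfl).and (hk q hq.le)).and (hk q' hq'.le))).exists
  have hP : 0 < p ^ m := by positivity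
  have hZ' {i : ℕ} (hi : (i + digitSum p r k m) / p ^ m = β) :=
    hZm ▸ apply_eq_letterAt_of_div_eq h hp0 hZ hi
  have hW' {i : ℕ} (hi : (i + digitSum p r k m) / p ^ m = β) :=
    hWm ▸ apply_eq_letterAt_of_div_eq h hp0 hW hi
  exact ⟨m, Z k β, W k β, _, _, _,
    { letterAt_left := (hZ' hm).symm
      letterAt_right := (hW' hm).symm
      lt_eq := mod_lt_mod_of_div_eq (by omega) (hm.trans hmq.symm)
      lt_ne := mod_lt_mod_of_div_eq (by omega) (hm.trans hmq'.symm)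
      eq_lt := Nat.mod_lt _ hP
      ne_lt := Nat.mod_lt _ hP
      letterAt_eq := by rw [← hZ' hmq, ← hW' hmq, hqq]
      letterAt_ne := by rwa [← hZ' hmq', ← hW' hmq'] }⟩

theorem IsSymbolicLiYorkePair.exists_isBranching [Finite A] [TopologicalSpace A]
    [DiscreteTopology A] (h : IsConstantLength τ p) (hp : 2 ≤ p) (hprim : IsPrimitiveSubst τ)
    (hinj : Function.Injective τ) {x y : ℤ → A} (hx : x ∈ substShift τ) (hy : y ∈ substShift τ)
    (hxy : IsSymbolicLiYorkePair x y) :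
    ∃ (m : ℕ) (a b : A) (r q q' : ℕ), IsBranching τ p m a b r q q' := by
  obtain ⟨Z, W, r, hseq⟩ := hxy.exists_inflate_seq h hp hprim hinj hx hy
  exact exists_isBranching_of_seq h hp (fun k => (hseq k).2.1) (fun k => (hseq k).1)
    (fun k => (hseq k).2.2.1) (fun k => (hseq k).2.2.2)

end Forward

section Splitting

variable {A : Type*} {τ : A → List A} {p m : ℕ} {a b : A}

theorem eq_append_cons_iff {w u v : List A} :
    w = u ++ a :: v ↔ w[u.length]? = some a ∧ w.take u.length = u ∧ w.drop (u.length + 1) = v := by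
  constructor
  · rintro rfl
    simp [← List.drop_drop]
  · rintro ⟨ha, hu, hv⟩
    obtain ⟨hlt, rfl⟩ := List.getElem?_eq_some_iff.1 ha
    conv_rhs => rw [← hv, ← List.drop_eq_getElem_cons hlt]
    exact (List.take_append_drop u.length w).symm.trans (congrArg (· ++ _) hu)

theorem iterWord_getElem?_eq_some_iff (h : IsConstantLength τ p) {i : ℕ} {c : A} :
    (iterWord τ m a)[i]? = some c ↔ i < p ^ m ∧ letterAt τ m a i = c := by
  by_cases hi : i < p ^ m
  · simp [iterWord_getElem? h hi, hi]
  · simp [iterWord_length h, hi]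

theorem hasCoincidence_drop_iterWord_iff (h : IsConstantLength τ p) {s : ℕ} :
    HasCoincidence ((iterWord τ m a).drop s) ((iterWord τ m b).drop s) ↔
      ∃ q ≥ s, q < p ^ m ∧ letterAt τ m a q = letterAt τ m b q := by
  simp only [HasCoincidence, List.getElem?_drop, iterWord_getElem?_eq_some_iff h]
  constructor
  · rintro ⟨i, c, ⟨hi, hac⟩, -, hbc⟩
    exact ⟨s + i, by omega, hi, hac.trans hbc.symm⟩
  · rintro ⟨q, hsq, hq, hab⟩
    obtain ⟨i, rfl⟩ := Nat.exists_eq_add_of_le hsq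
    exact ⟨i, _, ⟨hq, rfl⟩, hq, hab.symm⟩

theorem drop_iterWord_ne_iff (h : IsConstantLength τ p) {s : ℕ} :
    (iterWord τ m a).drop s ≠ (iterWord τ m b).drop s ↔
      ∃ q ≥ s, q < p ^ m ∧ letterAt τ m a q ≠ letterAt τ m b q := by
  rw [← not_iff_not]
  push Not
  constructor
  · intro he q hsq hq
    obtain ⟨i, rfl⟩ := Nat.exists_eq_add_of_le hsq
    rw [← Option.some_inj, ← iterWord_getElem? h hq, ← iterWord_getElem? h hq, ← List.getElem?_drop,
      ← List.getElem?_drop, he]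
  · refine fun hab => List.ext_getElem? fun i => ?_
    rw [List.getElem?_drop, List.getElem?_drop]
    by_cases hi : s + i < p ^ m
    · rw [iterWord_getElem? h hi, iterWord_getElem? h hi, hab _ (by omega) hi]
    · rw [List.getElem?_eq_none (by rw [iterWord_length h]; omega),
        List.getElem?_eq_none (by rw [iterWord_length h]; omega)]

theorem IsBranching.ne {r q q' : ℕ} (hab : IsBranching τ p m a b r q q') : a ≠ b :=
  fun he => hab.letterAt_ne (he ▸ rfl)

theorem exists_split_iff_exists_isBranching (h : IsConstantLength τ p) :
    (∃ u v u' v' : List A, iterWord τ m a = u ++ a :: v ∧ iterWord τ m b = u' ++ b :: v' ∧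
        u.length = u'.length ∧ v.length = v'.length ∧ v ≠ v' ∧ HasCoincidence v v') ↔
      ∃ r q q' : ℕ, IsBranching τ p m a b r q q' := by
  constructor
  · rintro ⟨u, v, u', v', ha, hb, hu, -, hne, hco⟩
    obtain ⟨hua, -, rfl⟩ := eq_append_cons_iff.1 ha
    obtain ⟨hub, -, rfl⟩ := eq_append_cons_iff.1 hb
    rw [← hu] at hne hco hub
    obtain ⟨q, hrq, hq, heq⟩ := (hasCoincidence_drop_iterWord_iff h).1 hco
    obtain ⟨q', hrq', hq', hne⟩ := (drop_iterWord_ne_iff h).1 hne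
    exact ⟨_, q, q', ((iterWord_getElem?_eq_some_iff h).1 hua).2,
      ((iterWord_getElem?_eq_some_iff h).1 hub).2, hrq, hrq', hq, hq', heq, hne⟩
  · rintro ⟨r, q, q', hr⟩
    have hrm : r < p ^ m := hr.lt_eq.trans hr.eq_lt
    have split {c : A} (hc : letterAt τ m c r = c) :
        iterWord τ m c = (iterWord τ m c).take r ++ c :: (iterWord τ m c).drop (r + 1) := by
      have hl : ((iterWord τ m c).take r).length = r :=
        List.length_take_of_le (by rw [iterWord_length h]; exact hrm.le)
      rw [eq_append_cons_iff, hl]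
      exact ⟨(iterWord_getElem?_eq_some_iff h).2 ⟨hrm, hc⟩, rfl, rfl⟩
    refine ⟨_, _, _, _, split hr.letterAt_left, split hr.letterAt_right, ?_, ?_,
      (drop_iterWord_ne_iff h).2 ⟨q', hr.lt_ne, hr.ne_lt, hr.letterAt_ne⟩,
      (hasCoincidence_drop_iterWord_iff h).2 ⟨q, hr.lt_eq, hr.eq_lt, hr.letterAt_eq⟩⟩
    · simp only [List.length_take, iterWord_length h]
    · simp only [List.length_drop, iterWord_length h]

end Splitting

section Backward

theorem exists_forall_mem_image_iterate {X : Type*} [TopologicalSpace X] [T2Space X] {K : Set X}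
    (hK : IsCompact K) (hne : K.Nonempty) {Φ : X → X} (hΦ : Continuous Φ)
    (hmaps : Set.MapsTo Φ K K) : ∃ x, ∀ k : ℕ, x ∈ Φ^[k] '' K := by
  have hcpt (k : ℕ) : IsCompact (Φ^[k] '' K) := hK.image (hΦ.iterate k)
  obtain ⟨x, hx⟩ := IsCompact.nonempty_iInter_of_sequence_nonempty_isCompact_isClosed
    (fun k => Φ^[k] '' K)
    (fun k => by
      rw [Function.iterate_succ, Set.image_comp]
      exact Set.image_mono hmaps.image_subset)
    (fun k => hne.image _) (hcpt 0) (fun k => (hcpt k).isClosed)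
  exact ⟨x, Set.mem_iInter.1 hx⟩

variable {A : Type*} {τ : A → List A} {p : ℕ}

theorem exists_iterate_inflate_eq (h : IsConstantLength τ p) (hp : 0 < p) {m r : ℕ}
    (hr : r + 2 ≤ p ^ m) (k : ℕ) : ∃ ρ : ℕ, ρ + k + 1 ≤ (p ^ m) ^ k ∧
      ∀ x : ℤ → A, (inflate τ p m r)^[k] x = inflate τ p (m * k) ρ x := by
  induction k with
  | zero => exact ⟨0, by simp, fun x => by simp [inflate_zero]⟩
  | succ k ih =>
    obtain ⟨ρ, hρ, hiter⟩ := ih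
    refine ⟨ρ + r * (p ^ m) ^ k, ?_, fun x => ?_⟩
    · calc ρ + r * (p ^ m) ^ k + (k + 1) + 1 ≤ (p ^ m) ^ k * (r + 2) := by linarith
        _ ≤ (p ^ m) ^ k * p ^ m := Nat.mul_le_mul_left _ hr
        _ = (p ^ m) ^ (k + 1) := (pow_succ _ k).symm
    · rw [Function.iterate_succ_apply, hiter, inflate_inflate h hp, mul_add_one]
      push_cast
      rw [pow_mul]

theorem exists_eqOn_iterate_inflate_iff (h : IsConstantLength τ p) (hp : 0 < p)
    (hinj : Function.Injective τ) {m r q : ℕ} (hrq : r < q) (hq : q < p ^ m) (k : ℕ) :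
    ∃ s > k, ∀ u v : ℤ → A,
      Set.EqOn ((inflate τ p m r)^[k + 1] u) ((inflate τ p m r)^[k + 1] v)
          (Set.Ico (s : ℤ) (s + (p ^ m) ^ k)) ↔
        letterAt τ m (u 0) q = letterAt τ m (v 0) q := by
  obtain ⟨ρ, hρ, hiter⟩ := exists_iterate_inflate_eq h hp (by omega : r + 2 ≤ p ^ m) k
  have hle : (p ^ m) ^ k ≤ (q - r) * (p ^ m) ^ k := Nat.le_mul_of_pos_left _ (by omega)
  have hs : (((q - r) * (p ^ m) ^ k - ρ : ℕ) : ℤ) = (q - r) * (p : ℤ) ^ (m * k) - ρ := by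
    push_cast [Nat.cast_sub (by omega : ρ ≤ (q - r) * (p ^ m) ^ k), Nat.cast_sub hrq.le]
    rw [pow_mul]
  refine ⟨(q - r) * (p ^ m) ^ k - ρ, by omega, fun u v => ?_⟩
  have hletter (x : ℤ → A) : inflate τ p m r x ((q : ℤ) - r) = letterAt τ m (x 0) q :=
    inflate_apply x hq (by ring)
  rw [Function.iterate_succ_apply, Function.iterate_succ_apply, hiter, hiter, hs, ← hletter,
    ← hletter, ← inflate_eqOn_Ico_iff h hinj (m * k) ρ, ← pow_mul]
  ring_nf

variable [Finite A] [TopologicalSpace A] [DiscreteTopology A]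

theorem exists_mem_substShift_forall_iterate_inflate_eq (h : IsConstantLength τ p) (hp : 2 ≤ p)
    (hprim : IsPrimitiveSubst τ) {m r : ℕ} {a : A} (hr : r < p ^ m) (ha : letterAt τ m a r = a) :
    ∃ x ∈ substShift τ, ∀ k : ℕ, ∃ u : ℤ → A, u 0 = a ∧ (inflate τ p m r)^[k] u = x := by
  obtain ⟨u, hu, hua⟩ := exists_mem_substShift_apply_zero_eq h hp hprim a
  have hcpt : IsCompact (substShift τ ∩ {x | x 0 = a}) :=
    (isCompact_substShift h hp hprim).inter_right (isClosed_eq (by fun_prop) continuous_const)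
  obtain ⟨x, hx⟩ := exists_forall_mem_image_iterate hcpt ⟨u, hu, hua⟩ (continuous_inflate τ p m r)
    fun y ⟨hy, (hya : y 0 = a)⟩ => ⟨inflate_mem_substShift h hp hprim hy m r,
      by rw [Set.mem_ofPred_eq, inflate_apply y hr (by ring : (0 : ℤ) + r = 0 * _ + r), hya, ha]⟩
  obtain ⟨x', hx', rfl⟩ := hx 0
  exact ⟨x', hx'.1, fun k => (hx k).imp fun u hu => ⟨hu.1.2, hu.2⟩⟩

theorem IsBranching.exists_isSymbolicLiYorkePair (h : IsConstantLength τ p) (hp : 2 ≤ p)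
    (hprim : IsPrimitiveSubst τ) (hinj : Function.Injective τ) {m r q q' : ℕ} {a b : A}
    (hab : IsBranching τ p m a b r q q') :
    ∃ x ∈ substShift τ, ∃ y ∈ substShift τ, IsSymbolicLiYorkePair x y := by
  have hp0 : 0 < p := by omega
  have hrm : r < p ^ m := hab.lt_eq.trans hab.eq_lt
  obtain ⟨x, hx, hxa⟩ :=
    exists_mem_substShift_forall_iterate_inflate_eq h hp hprim hrm hab.letterAt_left
  obtain ⟨y, hy, hyb⟩ :=
    exists_mem_substShift_forall_iterate_inflate_eq h hp hprim hrm hab.letterAt_right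
  have hblock {j : ℕ} (hrj : r < j) (hj : j < p ^ m) (k : ℕ) :
      ∃ s > k, Set.EqOn x y (Set.Ico (s : ℤ) (s + (p ^ m) ^ k)) ↔
        letterAt τ m a j = letterAt τ m b j := by
    obtain ⟨s, hs, hiff⟩ := exists_eqOn_iterate_inflate_iff h hp0 hinj hrj hj k
    obtain ⟨u, rfl, hu⟩ := hxa (k + 1)
    obtain ⟨v, rfl, hv⟩ := hyb (k + 1)
    exact ⟨s, hs, hu ▸ hv ▸ hiff u v⟩
  refine ⟨x, hx, y, hy, frequently_atTop.2 fun N => ?_, fun L => frequently_atTop.2 fun N => ?_⟩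
  · obtain ⟨s, hs, hiff⟩ := hblock hab.lt_ne hab.ne_lt N
    have hne := mt hiff.1 hab.letterAt_ne
    simp only [Set.EqOn, not_forall] at hne
    obtain ⟨i, hi, hxy⟩ := hne
    lift i to ℕ using (Int.natCast_nonneg s).trans hi.1
    exact ⟨i, by have := hi.1; omega, hxy⟩
  · obtain ⟨s, hs, hiff⟩ := hblock hab.lt_eq hab.eq_lt (2 * L + N)
    have hlong : 2 * L + N < (p ^ m) ^ (2 * L + N) :=
      Nat.lt_pow_self (by have := hab.lt_eq; have := hab.eq_lt; omega)
    zify at hlong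
    refine ⟨s + L, by omega, (hiff.2 hab.letterAt_eq).mono fun i hi => ?_⟩
    rw [Set.mem_Icc] at hi
    push_cast at hi
    constructor <;> linarith

end Backward

section Metric

theorem isLiYorkePair_iff_frequently {X : Type*} [MetricSpace X] [BoundedSpace X] {T : X → X}
    {x y : X} : IsLiYorkePair T x y ↔
      (∃ ε > 0, ∃ᶠ n : ℕ in atTop, ε ≤ dist (T^[n] x) (T^[n] y)) ∧
        ∀ ε > 0, ∃ᶠ n : ℕ in atTop, dist (T^[n] x) (T^[n] y) < ε := by
  have hle : IsBoundedUnder (· ≤ ·) atTop fun n : ℕ => dist (T^[n] x) (T^[n] y) :=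
    isBoundedUnder_of ⟨_, fun n => Metric.dist_le_diam_of_mem (Bornology.IsBounded.all Set.univ)
      (Set.mem_univ _) (Set.mem_univ _)⟩
  have hge : IsBoundedUnder (· ≥ ·) atTop fun n : ℕ => dist (T^[n] x) (T^[n] y) :=
    isBoundedUnder_of ⟨0, fun n => dist_nonneg⟩
  have hliminf : 0 ≤ liminf (fun n : ℕ => dist (T^[n] x) (T^[n] y)) atTop :=
    le_liminf_of_le hle.isCoboundedUnder_ge (.of_forall fun n => dist_nonneg)
  refine and_congr ⟨fun hpos => ?_, fun ⟨ε, hε, hfreq⟩ => ?_⟩ ?_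
  · obtain ⟨ε, hε, hlt⟩ := exists_between hpos
    exact ⟨ε, hε, (frequently_lt_of_lt_limsup hge.isCoboundedUnder_le hlt).mono fun n => le_of_lt⟩
  · exact hε.trans_le (le_limsup_of_frequently_le hfreq hle)
  · rw [← hliminf.ge_iff_eq', liminf_le_iff hle.isCoboundedUnder_ge hge]

variable {A X : Type*} [TopologicalSpace A] [DiscreteTopology A] [MetricSpace X] [CompactSpace X]
  {f : X → ℤ → A}

theorem exists_forall_dist_lt_of_eqOn_Icc (hf : Continuous f) (hinj : Function.Injective f) {ε : ℝ}
    (hε : 0 < ε) :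
    ∃ L : ℕ, ∀ x y, Set.EqOn (f x) (f y) (Set.Icc (-L : ℤ) L) → dist x y < ε := by
  by_contra! hfar
  have hK : IsClosed {P : X × X | ε ≤ dist P.1 P.2} :=
    isClosed_le continuous_const (continuous_fst.dist continuous_snd)
  obtain ⟨⟨x, y⟩, hxy, he⟩ := exists_eq_of_forall_exists_eqOn_Icc hK.isCompact
    (hf.comp continuous_fst) (hf.comp continuous_snd)
    fun L => let ⟨x, y, heq, hxy⟩ := hfar L; ⟨(x, y), hxy, heq⟩
  obtain rfl : x = y := hinj he
  exact hε.not_ge (by simpa using hxy)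

theorem exists_forall_eqOn_Icc_of_dist_lt (hf : Continuous f) (L : ℕ) :
    ∃ ε > 0, ∀ x y, dist x y < ε → Set.EqOn (f x) (f y) (Set.Icc (-L : ℤ) L) := by
  have hopen : IsOpen {P : X × X | Set.EqOn (f P.1) (f P.2) (Set.Icc (-L : ℤ) L)} := by
    simp only [Set.EqOn, Set.ofPred_forall]
    exact (Set.finite_Icc _ _).isOpen_biInter fun i _ =>
      (isOpen_discrete (Set.diagonal A)).preimage (f := fun P : X × X => (f P.1 i, f P.2 i))
        (by fun_prop)
  have hdiag : Set.diagonal X ⊆ {P | Set.EqOn (f P.1) (f P.2) (Set.Icc (-L : ℤ) L)} := by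
    rintro ⟨x, y⟩ (rfl : x = y)
    exact fun _ _ => rfl
  have hnhds := hopen.mem_nhdsSet.2 hdiag
  rw [nhdsSet_diagonal_eq_uniformity] at hnhds
  exact Metric.mem_uniformity_dist.1 hnhds

theorem isLiYorkePair_iff_isSymbolicLiYorkePair (hf : Continuous f) (hinj : Function.Injective f)
    {T : X → X} (hT : ∀ (n : ℕ) (x : X) (i : ℤ), f (T^[n] x) i = f x (i + n)) {x y : X} :
    IsLiYorkePair T x y ↔ IsSymbolicLiYorkePair (f x) (f y) := by
  have hwindow (n L : ℕ) : Set.EqOn (f (T^[n] x)) (f (T^[n] y)) (Set.Icc (-L : ℤ) L) ↔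
      Set.EqOn (f x) (f y) (Set.Icc (n - L : ℤ) (n + L)) := by
    simp only [Set.EqOn, hT]
    rw [(Equiv.addRight (n : ℤ)).forall_congr_left]
    simp [sub_eq_add_neg, add_comm]
  rw [isLiYorkePair_iff_frequently]
  constructor
  · rintro ⟨⟨ε, hε, hfar⟩, hclose⟩
    refine ⟨frequently_atTop.2 fun N => ?_, fun L => ?_⟩
    · obtain ⟨L, hL⟩ := exists_forall_dist_lt_of_eqOn_Icc hf hinj hε
      obtain ⟨n, hn, hdist⟩ := frequently_atTop.1 hfar (N + L)
      have hne := mt (hL _ _) hdist.not_gt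
      rw [hwindow] at hne
      simp only [Set.EqOn, not_forall] at hne
      obtain ⟨i, hi, hne⟩ := hne
      lift i to ℕ using by have := hi.1; omega
      exact ⟨i, by have := hi.1; omega, hne⟩
    · obtain ⟨ε, hε, heq⟩ := exists_forall_eqOn_Icc_of_dist_lt hf L
      exact (hclose ε hε).mono fun n hn => (hwindow n L).1 (heq _ _ hn)
  · rintro ⟨hne, heq⟩
    refine ⟨?_, fun ε hε => ?_⟩
    · obtain ⟨ε, hε, hdist⟩ := exists_forall_eqOn_Icc_of_dist_lt hf 0
      refine ⟨ε, hε, hne.mono fun n hn => not_lt.1 fun hlt => hn ?_⟩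
      exact (hwindow n 0).1 (hdist _ _ hlt) (by simp)
    · obtain ⟨L, hL⟩ := exists_forall_dist_lt_of_eqOn_Icc hf hinj hε
      exact (heq L).mono fun n hn => hL _ _ ((hwindow n L).2 hn)

end Metric

theorem substShiftMap_iterate_apply {A : Type*} [TopologicalSpace A] {τ : A → List A} (n : ℕ)
    (x : substShift τ) (i : ℤ) : ((substShiftMap τ)^[n] x).1 i = x.1 (i + n) := by
  induction n generalizing x with
  | zero => simp
  | succ n ih =>
    rw [Function.iterate_succ_apply, ih, Nat.cast_succ, ← add_assoc]
    rfl

theorem proposition3p5_general {A : Type*} [Finite A] [TopologicalSpace A] [DiscreteTopology A]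
    (τ : A → List A) (p : ℕ) (hp : 2 ≤ p) (hlen : IsConstantLength τ p)
    (hprim : IsPrimitiveSubst τ) (hinj : Function.Injective τ) [ρ : MetricSpace (substShift τ)]
    (hρ : ρ.toPseudoMetricSpace.toUniformSpace.toTopologicalSpace =
      (instTopologicalSpaceSubtype : TopologicalSpace (substShift τ))) :
    (∃ x y : substShift τ, IsLiYorkePair (substShiftMap τ) x y) ↔
      ∃ (m : ℕ) (a b : A) (u v u' v' : List A), a ≠ b ∧
        iterWord τ m a = u ++ a :: v ∧ iterWord τ m b = u' ++ b :: v' ∧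
        u.length = u'.length ∧ v.length = v'.length ∧ v ≠ v' ∧ HasCoincidence v v' := by
  have hcpt : @CompactSpace (substShift τ)
      ρ.toPseudoMetricSpace.toUniformSpace.toTopologicalSpace :=
    hρ ▸ isCompact_iff_compactSpace.1 (isCompact_substShift hlen hp hprim)
  have hval : @Continuous (substShift τ) (ℤ → A)
      ρ.toPseudoMetricSpace.toUniformSpace.toTopologicalSpace _ Subtype.val :=
    hρ ▸ continuous_subtype_val
  simp only [isLiYorkePair_iff_isSymbolicLiYorkePair hval Subtype.val_injective
    substShiftMap_iterate_apply]
  constructor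
  · rintro ⟨x, y, hxy⟩
    obtain ⟨m, a, b, hab⟩ := hxy.exists_isBranching hlen hp hprim hinj x.2 y.2
    obtain ⟨u, v, u', v', hsplit⟩ := (exists_split_iff_exists_isBranching hlen).2 hab
    obtain ⟨r, q, q', hab⟩ := hab
    exact ⟨m, a, b, u, v, u', v', hab.ne, hsplit⟩
  · rintro ⟨m, a, b, u, v, u', v', -, hsplit⟩
    obtain ⟨r, q, q', hab⟩ :=
      (exists_split_iff_exists_isBranching hlen).1 ⟨u, v, u', v', hsplit⟩
    obtain ⟨x, hx, y, hy, hxy⟩ := hab.exists_isSymbolicLiYorkePair hlen hp hprim hinj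
    exact ⟨⟨x, hx⟩, ⟨y, hy⟩, hxy⟩

theorem proposition3p5 {A : Type*} [Finite A] [TopologicalSpace A] [DiscreteTopology A]
    (τ : A → List A) (p : ℕ) (hp : 2 ≤ p) (hlen : IsConstantLength τ p)
    (hprim : IsPrimitiveSubst τ) (hinj : Function.Injective τ)
    (hinf : (substShift τ).Infinite)
    -- any metric inducing on `X_τ` its topology as a subspace of the product `A ^ ℤ`
    [ρ : MetricSpace (substShift τ)]
    (hρ : ρ.toPseudoMetricSpace.toUniformSpace.toTopologicalSpace =
      (instTopologicalSpaceSubtype : TopologicalSpace (substShift τ))) :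
    (∃ x y : substShift τ, IsLiYorkePair (substShiftMap τ) x y) ↔
      ∃ (m : ℕ) (a b : A) (u v u' v' : List A), a ≠ b ∧
        iterWord τ m a = u ++ a :: v ∧ iterWord τ m b = u' ++ b :: v' ∧
        u.length = u'.length ∧ v.length = v'.length ∧ v ≠ v' ∧ HasCoincidence v v' :=
  proposition3p5_general τ p hp hlen hprim hinj hρ
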